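/- Let $\Lambda$ be a two-sided noetherian ring; modules are right $\Lambda$-modules, $\operatorname{mod}\Lambda$ is the category of finitely generated ones, $\operatorname{proj}\Lambda$ that of finitely generated projective ones, and $(-)^*=\operatorname{Hom}_\Lambda(-,\Lambda)$. Let $n\ge 0$ be an integer. Definitions. For $M\in\operatorname{mod}\Lambda$, a syzygy $\Omega M$ is the kernel of a surjection $P_0\to M$ with $P_0\in\operatorname{proj}\Lambda$; $\Omega^0M=M$ and $\Omega^{k+1}M=\Omega(\Omega^{k}M)$. A transpose $\operatorname{Tr}M$ is the cokernel of $\partial^*:P_0^*\to P_1^*$ for an exact sequence $P_1\xrightarrow{\partial}P_0\to M\to0$ with $P_0,P_1\in\operatorname{proj}\Lambda$; it is a left $\Lambda$-module. Both are unique up to projective direct summands, and the statements below hold for every choice of them. $M$ is *torsionless* if the natural map $M\to M^{**}$ is injective, and *$k$-torsionfree* if $\operatorname{Ext}^i_{\Lambda^{\mathrm{op}}}(\operatorname{Tr}M,\Lambda)=0$ for all $1\le i\le k$. Let $\operatorname{pd}$ denote projective dimension ($\operatorname{pd}Y\le -1$ means $Y=0$). A short exact sequence in $\operatorname{mod}\Lambda$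 of the form - $0\to Y\to X\to M\to0$ is an *$n$-AB approximation* of $M$ if $\operatorname{pd}Y\le n-1$ and $\operatorname{Ext}^i_\Lambda(X,\Lambda)=0$ for $1\le i\le n$; - $0\to X\to M\oplus P\to Y\to0$ is an *$n$-origin extension* of $M$ if $P$ is projective, $\operatorname{pd}Y\le n$ and $\operatorname{Ext}^i_\Lambda(X,\Lambda)=0$ for $1\le i\le n$; - $0\to M\to Y\to X\to0$ is an *$n$-FPD hull* of $M$ if $\operatorname{pd}Y\le n$ and $\operatorname{Ext}^i_\Lambda(X,\Lambda)=0$ for $1\le i\le n+1$. A *left $\operatorname{proj}\Lambda$-approximation* of $W$ is a homomorphism $s:W\to P$ with $P\in\operatorname{proj}\Lambda$ through which every homomorphism from $W$ to an object of $\operatorname{proj}\Lambda$ factors. Theorem. Let $M$ be a finitely generated $\Lambda$-module. The following are equivalent. 1. The $n$-th syzygy $\Omega^nM$ is $(n+1)$-torsionfree. 2. $M$ has an $n$-FPD hull. 3. $M$ has an $n$-AB approximation $0\to Z\to W\to M\to0$ with $W$ torsionless. 4. $M$ has an $n$-origin extension $0\to X'\to M\oplus P\to Y'\to0$ with $X'$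 torsionless. Moreover, for any $n$-AB approximation $0\to Z\to W\xrightarrow{f}M\to0$ with $W$ torsionless and any left $\operatorname{proj}\Lambda$-approximation $s:W\to P$ of $W$, the sequence $$0\to M\to Y\to X\to 0,\qquad Y=\operatorname{Coker}\left(\tbinom{f}{s}:W\to M\oplus P\right),\quad X=\operatorname{Coker}s,$$ obtained from the pushout of $f$ and $s$ (with maps $m\mapsto[(m,0)]$ and $[(m,p)]\mapsto[-p]$), is exact and is an $n$-FPD hull of $M$. -/

import Mathlib

/-!
Modules over `Λ` are right modules, i.e. modules over `Λᵐᵒᵖ`; modules over the opposite ring of `Λ`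
are left modules, i.e. modules over `Λ`. All modules lie in the universe of `Λ`, where every
finitely generated module has an isomorphic copy.
-/

universe u

open CategoryTheory

namespace NFPDHull

section

variable (Λ : Type u) [Ring Λ]

/-- The `Λ`-dual `M^* = Hom_Λ(M, Λ)` of a right module; it is a left module by
`(a • f) x = a * f x`. -/
abbrev Dual (M : Type u) [AddCommGroup M] [Module Λᵐᵒᵖ M] : Type u := M →ₗ[Λᵐᵒᵖ] Λ

/-- The `Λ`-dual `∂^* : N^* → M^*`, `f ↦ f ∘ ∂`, of a homomorphism `∂ : M → N`. -/
def dualMap {M N : Type u} [AddCommGroup M] [Module Λᵐᵒᵖ M] [AddCommGroup N] [Module Λᵐᵒᵖ N]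
    (d : M →ₗ[Λᵐᵒᵖ] N) : Dual Λ N →ₗ[Λ] Dual Λ M where
  toFun f := f.comp d
  map_add' _ _ := rfl
  map_smul' _ _ := rfl

/-- The natural homomorphism `φ_M : M → M^{**}`, `φ_M x f = f x`. -/
def eval (M : Type u) [AddCommGroup M] [Module Λᵐᵒᵖ M] :
    M →ₗ[Λᵐᵒᵖ] (Dual Λ M →ₗ[Λ] Λ) where
  toFun x :=
    { toFun := fun f => f x
      map_add' := fun _ _ => rfl
      map_smul' := fun _ _ => rfl }
  map_add' x y := LinearMap.ext fun f => f.map_add x y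
  map_smul' a x := LinearMap.ext fun f => f.map_smul a x

/-- `M` is torsionless: `φ_M : M → M^{**}` is injective. -/
def IsTorsionless (M : Type u) [AddCommGroup M] [Module Λᵐᵒᵖ M] : Prop :=
  Function.Injective (eval Λ M)

/-- `Ext^i_S(X, D) = 0` for all `1 ≤ i ≤ k`. -/
def ExtVanishes (S : Type u) [Ring S] (X D : Type u) [AddCommGroup X] [Module S X]
    [AddCommGroup D] [Module S D] (k : ℕ) : Prop :=
  ∀ i : ℕ, 1 ≤ i → i ≤ k → Subsingleton (Abelian.Ext (ModuleCat.of S X) (ModuleCat.of S D) i)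

/-- `0 → A → B → C → 0` is a short exact sequence of finitely generated right modules. -/
structure IsShortExact {A B C : Type u} [AddCommGroup A] [Module Λᵐᵒᵖ A]
    [AddCommGroup B] [Module Λᵐᵒᵖ B] [AddCommGroup C] [Module Λᵐᵒᵖ C]
    (i : A →ₗ[Λᵐᵒᵖ] B) (p : B →ₗ[Λᵐᵒᵖ] C) : Prop where
  finite_left : Module.Finite Λᵐᵒᵖ A
  finite_mid : Module.Finite Λᵐᵒᵖ B
  finite_right : Module.Finite Λᵐᵒᵖ C
  injective : Function.Injective i
  exact : Function.Exact i p
  surjective : Function.Surjective p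

/-- `K` is an `n`-th syzygy `Ω^n M` of `M`: `Ω^0 M = M`, and `Ω^{n+1} M` is the kernel of a
surjection from a finitely generated projective module onto an `n`-th syzygy `Ω^n M`.
(Syzygies are determined up to projective summands only; `K` is any choice.) -/
def IsSyzygy (M : Type u) [AddCommGroup M] [Module Λᵐᵒᵖ M] :
    (n : ℕ) → (K : Type u) → [AddCommGroup K] → [Module Λᵐᵒᵖ K] → Prop
  | 0, K, _, _ => Nonempty (K ≃ₗ[Λᵐᵒᵖ] M)
  | n + 1, K, _, _ =>
    ∃ (L P : ModuleCat.{u} Λᵐᵒᵖ) (i : K →ₗ[Λᵐᵒᵖ] P) (p : P →ₗ[Λᵐᵒᵖ] L),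
      IsSyzygy M n L ∧ Module.Projective Λᵐᵒᵖ P ∧ IsShortExact Λ i p

/-- The left module `T` is an Auslander transpose `Tr M` of the right module `M`: for some finite
projective presentation `P₁ → P₀ → M → 0`, the module `T` is the cokernel of `P₀^* → P₁^*`. -/
def IsTranspose (M : Type u) [AddCommGroup M] [Module Λᵐᵒᵖ M]
    (T : Type u) [AddCommGroup T] [Module Λ T] : Prop :=
  ∃ (P₁ P₀ : ModuleCat.{u} Λᵐᵒᵖ) (d : P₁ →ₗ[Λᵐᵒᵖ] P₀) (p : P₀ →ₗ[Λᵐᵒᵖ] M)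
    (q : Dual Λ P₁ →ₗ[Λ] T),
    Module.Finite Λᵐᵒᵖ P₁ ∧ Module.Projective Λᵐᵒᵖ P₁ ∧
    Module.Finite Λᵐᵒᵖ P₀ ∧ Module.Projective Λᵐᵒᵖ P₀ ∧
    Function.Exact d p ∧ Function.Surjective p ∧
    Function.Exact (dualMap Λ d) q ∧ Function.Surjective q

/-- `M` is `k`-torsionfree: `Ext^i_{Λ^op}(Tr M, Λ) = 0` for all `1 ≤ i ≤ k`
(for every choice of the transpose). -/
def IsTorsionfree (k : ℕ) (M : Type u) [AddCommGroup M] [Module Λᵐᵒᵖ M] : Prop :=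
  ∀ (T : Type u) [AddCommGroup T] [Module Λ T], IsTranspose Λ M T → ExtVanishes Λ T Λ k

/-- `0 → Y → X → M → 0` is an `n`-AB approximation of `M`. Here `HasProjectiveDimensionLT _ n` says
that the projective dimension is at most `n - 1` (the module is zero if `n = 0`). -/
structure IsABApproximation (n : ℕ) {Y X M : Type u} [AddCommGroup Y] [Module Λᵐᵒᵖ Y]
    [AddCommGroup X] [Module Λᵐᵒᵖ X] [AddCommGroup M] [Module Λᵐᵒᵖ M]
    (i : Y →ₗ[Λᵐᵒᵖ] X) (f : X →ₗ[Λᵐᵒᵖ] M) : Prop where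
  shortExact : IsShortExact Λ i f
  pd : HasProjectiveDimensionLT (ModuleCat.of Λᵐᵒᵖ Y) n
  ext : ExtVanishes Λᵐᵒᵖ X Λ n

/-- `0 → X → M ⊕ P → Y → 0` is an `n`-origin extension of `M`. -/
structure IsOriginExtension (n : ℕ) {X M P Y : Type u} [AddCommGroup X] [Module Λᵐᵒᵖ X]
    [AddCommGroup M] [Module Λᵐᵒᵖ M] [AddCommGroup P] [Module Λᵐᵒᵖ P]
    [AddCommGroup Y] [Module Λᵐᵒᵖ Y]
    (i : X →ₗ[Λᵐᵒᵖ] M × P) (p : M × P →ₗ[Λᵐᵒᵖ] Y) : Prop where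
  shortExact : IsShortExact Λ i p
  projective : Module.Projective Λᵐᵒᵖ P
  pd : HasProjectiveDimensionLE (ModuleCat.of Λᵐᵒᵖ Y) n
  ext : ExtVanishes Λᵐᵒᵖ X Λ n

/-- `0 → M → Y → X → 0` is an `n`-FPD hull of `M`. -/
structure IsFPDHull (n : ℕ) {M Y X : Type u} [AddCommGroup M] [Module Λᵐᵒᵖ M]
    [AddCommGroup Y] [Module Λᵐᵒᵖ Y] [AddCommGroup X] [Module Λᵐᵒᵖ X]
    (g : M →ₗ[Λᵐᵒᵖ] Y) (p : Y →ₗ[Λᵐᵒᵖ] X) : Prop where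
  shortExact : IsShortExact Λ g p
  pd : HasProjectiveDimensionLE (ModuleCat.of Λᵐᵒᵖ Y) n
  ext : ExtVanishes Λᵐᵒᵖ X Λ (n + 1)

/-- `s : W → P` is a left `proj Λ`-approximation of `W`. -/
structure IsLeftProjApproximation {W P : Type u} [AddCommGroup W] [Module Λᵐᵒᵖ W]
    [AddCommGroup P] [Module Λᵐᵒᵖ P] (s : W →ₗ[Λᵐᵒᵖ] P) : Prop where
  finite : Module.Finite Λᵐᵒᵖ P
  projective : Module.Projective Λᵐᵒᵖ P
  factors : ∀ (Q : Type u) [AddCommGroup Q] [Module Λᵐᵒᵖ Q],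
    Module.Finite Λᵐᵒᵖ Q → Module.Projective Λᵐᵒᵖ Q →
      ∀ g : W →ₗ[Λᵐᵒᵖ] Q, ∃ h : P →ₗ[Λᵐᵒᵖ] Q, g = h.comp s

section Pushout

variable {W M P : Type u} [AddCommGroup W] [Module Λᵐᵒᵖ W] [AddCommGroup M] [Module Λᵐᵒᵖ M]
  [AddCommGroup P] [Module Λᵐᵒᵖ P] (f : W →ₗ[Λᵐᵒᵖ] M) (s : W →ₗ[Λᵐᵒᵖ] P)

/-- `Coker (f, s)`, for the map `(f, s) : W → M ⊕ P`, `w ↦ (f w, s w)`. It is a pushout of `f`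
and `s`. -/
abbrev PushoutCoker : Type u := (M × P) ⧸ LinearMap.range (f.prod s)

/-- The map `M → Coker (f, s)`, `m ↦ [(m, 0)]`. -/
def fromM : M →ₗ[Λᵐᵒᵖ] PushoutCoker Λ f s :=
  (LinearMap.range (f.prod s)).mkQ.comp (LinearMap.inl Λᵐᵒᵖ M P)

/-- The map `P → Coker (f, s)`, `p ↦ [(0, -p)]`. -/
def fromP : P →ₗ[Λᵐᵒᵖ] PushoutCoker Λ f s :=
  -(LinearMap.range (f.prod s)).mkQ.comp (LinearMap.inr Λᵐᵒᵖ M P)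

/-- The map `Coker (f, s) → Coker s`, `[(m, p)] ↦ [-p]`. It is the map from the pushout that
vanishes on `M` and restricts to the projection `P → Coker s` on `P`. -/
def toCoker : PushoutCoker Λ f s →ₗ[Λᵐᵒᵖ] P ⧸ LinearMap.range s :=
  (LinearMap.range (f.prod s)).liftQ (-(LinearMap.range s).mkQ.comp (LinearMap.snd Λᵐᵒᵖ M P)) (by
    rintro _ ⟨w, rfl⟩
    simp)

/-- The pushout diagram: the square commutes, and `toCoker` is induced by `0` on `M` and by the
projection on `P`. -/
theorem pushout_comm :
    (fromM Λ f s).comp f = (fromP Λ f s).comp s ∧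
    (toCoker Λ f s).comp (fromM Λ f s) = 0 ∧
    (toCoker Λ f s).comp (fromP Λ f s) = (LinearMap.range s).mkQ := by
  refine ⟨LinearMap.ext fun w => ?_, LinearMap.ext fun m => ?_, LinearMap.ext fun p => ?_⟩
  · simp only [fromM, fromP, LinearMap.comp_apply, LinearMap.neg_apply, eq_neg_iff_add_eq_zero,
      ← map_add]
    refine (Submodule.Quotient.mk_eq_zero _).2 ⟨w, ?_⟩
    simp
  · simp [fromM, toCoker]
  · simp [fromP, toCoker]

end Pushout

/-- Syzygies exist. -/
theorem exists_isSyzygy [IsNoetherianRing Λᵐᵒᵖ] (n : ℕ) (M : Type u) [AddCommGroup M]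
    [Module Λᵐᵒᵖ M] [Module.Finite Λᵐᵒᵖ M] :
    ∃ K : ModuleCat.{u} Λᵐᵒᵖ, Module.Finite Λᵐᵒᵖ K ∧ IsSyzygy Λ M n K := by
  induction n with
  | zero => exact ⟨ModuleCat.of Λᵐᵒᵖ M, ‹_›, ⟨LinearEquiv.refl _ _⟩⟩
  | succ n ih =>
    obtain ⟨L, hL, h⟩ := ih
    obtain ⟨m, p, hp⟩ := Module.Finite.exists_fin' Λᵐᵒᵖ L
    refine ⟨ModuleCat.of Λᵐᵒᵖ (LinearMap.ker p), inferInstanceAs (Module.Finite _ (LinearMap.ker p)),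
      L, ModuleCat.of Λᵐᵒᵖ (Fin m → Λᵐᵒᵖ), (LinearMap.ker p).subtype, p, h,
      inferInstanceAs (Module.Projective _ (Fin m → Λᵐᵒᵖ)), ?_⟩
    exact ⟨inferInstanceAs (Module.Finite _ (LinearMap.ker p)),
      inferInstanceAs (Module.Finite _ (Fin m → Λᵐᵒᵖ)), hL, Subtype.val_injective,
      LinearMap.exact_subtype_ker_map p, hp⟩

/-- Transposes exist. -/
theorem exists_isTranspose [IsNoetherianRing Λᵐᵒᵖ] (M : Type u) [AddCommGroup M]
    [Module Λᵐᵒᵖ M] [Module.Finite Λᵐᵒᵖ M] : ∃ T : ModuleCat.{u} Λ, IsTranspose Λ M T := by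
  obtain ⟨m, p, hp⟩ := Module.Finite.exists_fin' Λᵐᵒᵖ M
  obtain ⟨k, q, hq⟩ := Module.Finite.exists_fin' Λᵐᵒᵖ (LinearMap.ker p)
  let d : (Fin k → Λᵐᵒᵖ) →ₗ[Λᵐᵒᵖ] (Fin m → Λᵐᵒᵖ) := (LinearMap.ker p).subtype.comp q
  refine ⟨ModuleCat.of Λ (Dual Λ (Fin k → Λᵐᵒᵖ) ⧸ LinearMap.range (dualMap Λ d)),
    ModuleCat.of Λᵐᵒᵖ (Fin k → Λᵐᵒᵖ), ModuleCat.of Λᵐᵒᵖ (Fin m → Λᵐᵒᵖ), d, p,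
    (LinearMap.range (dualMap Λ d)).mkQ,
    inferInstanceAs (Module.Finite _ (Fin k → Λᵐᵒᵖ)),
    inferInstanceAs (Module.Projective _ (Fin k → Λᵐᵒᵖ)),
    inferInstanceAs (Module.Finite _ (Fin m → Λᵐᵒᵖ)),
    inferInstanceAs (Module.Projective _ (Fin m → Λᵐᵒᵖ)), ?_, hp,
    LinearMap.exact_map_mkQ_range _, Submodule.mkQ_surjective _⟩
  rw [LinearMap.exact_iff, LinearMap.range_comp, LinearMap.range_eq_top.2 hq]
  simp

end

end NFPDHull

/-! All four conditions are cases of one family. Grade a module by the length of a coresolution by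
finitely generated projectives that stays exact under duality. Length `k` exists exactly when the
module is `k`-torsionfree (`isTorsionfree_iff`), because the first syzygy of a transpose of `M` is a
transpose of the cokernel of the first coresolution map. Length 1 means torsionless.

Two exchanges then carry the proof. By `hasFPDHull_iff`, an `n`-hull `0 → M → Y → X → 0` with `X` of
length `m` exists iff there is an `n`-AB approximation `0 → Z → W → M → 0` with `W` of length `m +
1`: pull back along a projective surjection onto `Y`, or push out along the first coresolution map
of `W`. By `hasABApproximation_succ_iff`, an `(n + 1)`-AB approximation of `M` with `W` of length
`m` exists iff a syzygy of `M` has an `n`-hull with `X` of length `m`.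

So each syzygy trades one unit of `n` for one of `m` (`hasFPDHull_syzygy_iff`). An `n`-hull of `M`
with no condition on `X` becomes a `0`-hull of the `n`-th syzygy with `X` of length `n`, which is a
coresolution of length `n + 1`. The first exchange at `m = 0` links hulls with torsionless AB
approximations. Origin extensions arise from the same pushout, and a pullback leads back from them.
-/

namespace NFPDHull

/-! ### Dimension shifting for `Ext` and projective dimension. -/

section ExtVanishing

variable {S : Type u} [Ring S] {A B C D : Type u} [AddCommGroup A] [Module S A]
  [AddCommGroup B] [Module S B] [AddCommGroup C] [Module S C] [AddCommGroup D] [Module S D]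
  {i : A →ₗ[S] B} {p : B →ₗ[S] C}

/-- The short complex of modules attached to an exact pair of linear maps. -/
abbrev shortComplexOfExact (h : Function.Exact i p) : ShortComplex (ModuleCat.{u} S) :=
  ShortComplex.mk (ModuleCat.ofHom i) (ModuleCat.ofHom p) (by
    ext x
    exact h.apply_apply_eq_zero x)

theorem shortExact_shortComplexOfExact (hi : Function.Injective i) (h : Function.Exact i p)
    (hp : Function.Surjective p) : (shortComplexOfExact h).ShortExact :=
  ModuleCat.shortComplex_shortExact _ h hi hp

theorem subsingleton_ext_right_succ (hi : Function.Injective i) (h : Function.Exact i p)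
    (hp : Function.Surjective p) {k : ℕ}
    (hA : Subsingleton (Abelian.Ext (ModuleCat.of S A) (ModuleCat.of S D) k))
    (hB : Subsingleton (Abelian.Ext (ModuleCat.of S B) (ModuleCat.of S D) (k + 1))) :
    Subsingleton (Abelian.Ext (ModuleCat.of S C) (ModuleCat.of S D) (k + 1)) := by
  refine subsingleton_of_forall_eq 0 fun x => ?_
  obtain ⟨y, rfl⟩ := Abelian.Ext.contravariant_sequence_exact₃
    (shortExact_shortComplexOfExact hi h hp) (ModuleCat.of S D) x (hB.elim _ _) (add_comm 1 k)
  rw [hA.elim y 0, Abelian.Ext.comp_zero]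

theorem subsingleton_ext_left (hi : Function.Injective i) (h : Function.Exact i p)
    (hp : Function.Surjective p) {k : ℕ}
    (hB : Subsingleton (Abelian.Ext (ModuleCat.of S B) (ModuleCat.of S D) k))
    (hC : Subsingleton (Abelian.Ext (ModuleCat.of S C) (ModuleCat.of S D) (k + 1))) :
    Subsingleton (Abelian.Ext (ModuleCat.of S A) (ModuleCat.of S D) k) := by
  refine subsingleton_of_forall_eq 0 fun x => ?_
  obtain ⟨y, rfl⟩ := Abelian.Ext.contravariant_sequence_exact₁
    (shortExact_shortComplexOfExact hi h hp) (ModuleCat.of S D) x (add_comm 1 k) (hC.elim _ _)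
  rw [hB.elim y 0, Abelian.Ext.comp_zero]

theorem subsingleton_ext_mid (hi : Function.Injective i) (h : Function.Exact i p)
    (hp : Function.Surjective p) {k : ℕ}
    (hA : Subsingleton (Abelian.Ext (ModuleCat.of S A) (ModuleCat.of S D) k))
    (hC : Subsingleton (Abelian.Ext (ModuleCat.of S C) (ModuleCat.of S D) k)) :
    Subsingleton (Abelian.Ext (ModuleCat.of S B) (ModuleCat.of S D) k) := by
  refine subsingleton_of_forall_eq 0 fun x => ?_
  obtain ⟨y, rfl⟩ := Abelian.Ext.contravariant_sequence_exact₂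
    (shortExact_shortComplexOfExact hi h hp) (ModuleCat.of S D) x (hA.elim _ _)
  rw [hC.elim y 0, Abelian.Ext.comp_zero]

theorem extVanishes_of_projective [Module.Projective S A] (k : ℕ) : ExtVanishes S A D k := by
  intro j hj _
  obtain ⟨j, rfl⟩ := Nat.exists_eq_succ_of_ne_zero (Nat.one_le_iff_ne_zero.1 hj)
  have : Projective (ModuleCat.of S A) := (IsProjective.iff_projective A).1 ‹_›
  exact subsingleton_of_forall_eq 0 fun x => Abelian.Ext.eq_zero_of_projective x

theorem ExtVanishes.mono {k l : ℕ} (h : ExtVanishes S A D l) (hkl : k ≤ l) :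
    ExtVanishes S A D k := fun j hj hjk => h j hj (hjk.trans hkl)

theorem extVanishes_zero : ExtVanishes S A D 0 := fun _ hj hj' => absurd (hj.trans hj') (by simp)

theorem ExtVanishes.mid {k : ℕ} (hi : Function.Injective i) (h : Function.Exact i p)
    (hp : Function.Surjective p) (hA : ExtVanishes S A D k) (hC : ExtVanishes S C D k) :
    ExtVanishes S B D k := fun j hj hjk =>
  subsingleton_ext_mid hi h hp (hA j hj hjk) (hC j hj hjk)

theorem ExtVanishes.left {k : ℕ} (hi : Function.Injective i) (h : Function.Exact i p)
    (hp : Function.Surjective p) (hB : ExtVanishes S B D k) (hC : ExtVanishes S C D (k + 1)) :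
    ExtVanishes S A D k := fun j hj hjk =>
  subsingleton_ext_left hi h hp (hB j hj hjk) (hC (j + 1) (by lia) (by lia))

/-- The long exact sequence yields degrees at least 2 only: in degree 1 the preceding term is
`Hom(A, D)`, which need not vanish. Hence the separate hypothesis `hC`. -/
theorem ExtVanishes.right {k : ℕ} (hi : Function.Injective i) (h : Function.Exact i p)
    (hp : Function.Surjective p) (hA : ExtVanishes S A D k) (hB : ExtVanishes S B D (k + 1))
    (hC : ExtVanishes S C D 1) : ExtVanishes S C D (k + 1) := by
  intro j hj hjk
  obtain rfl | hj1 := hj.eq_or_lt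
  · exact hC 1 le_rfl le_rfl
  · obtain ⟨j, rfl⟩ := Nat.exists_eq_succ_of_ne_zero (Nat.one_le_iff_ne_zero.1 hj)
    exact subsingleton_ext_right_succ hi h hp (hA j (by lia) (by lia)) (hB (j + 1) hj hjk)

theorem ExtVanishes.exists_extension (hi : Function.Injective i) (h : Function.Exact i p)
    (hp : Function.Surjective p) (hC : ExtVanishes S C D 1) (f : A →ₗ[S] D) :
    ∃ g : B →ₗ[S] D, g.comp i = f := by
  obtain ⟨y, hy⟩ := Abelian.Ext.contravariant_sequence_exact₁
    (shortExact_shortComplexOfExact hi h hp) (ModuleCat.of S D)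
    (Abelian.Ext.mk₀ (ModuleCat.ofHom f)) (add_comm 1 0) ((hC 1 le_rfl le_rfl).elim _ _)
  obtain ⟨g, rfl⟩ := (Abelian.Ext.mk₀_bijective _ _).2 y
  rw [Abelian.Ext.mk₀_comp_mk₀] at hy
  exact ⟨g.hom, congrArg ModuleCat.Hom.hom ((Abelian.Ext.mk₀_bijective _ _).1 hy)⟩

/-- As `Ext¹(B, D) = 0`, every class in `Ext¹(C, D)` is the extension class pushed along some `f : A
→ D`, and it dies once `f` extends to `B`. -/
theorem extVanishes_one_of_extension (hi : Function.Injective i) (h : Function.Exact i p)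
    (hp : Function.Surjective p) (hB : ExtVanishes S B D 1)
    (hext : ∀ f : A →ₗ[S] D, ∃ g : B →ₗ[S] D, g.comp i = f) : ExtVanishes S C D 1 := by
  intro j hj hj'
  obtain rfl := le_antisymm hj' hj
  refine subsingleton_of_forall_eq 0 fun x => ?_
  obtain ⟨y, rfl⟩ := Abelian.Ext.contravariant_sequence_exact₃
    (shortExact_shortComplexOfExact hi h hp) (ModuleCat.of S D) x
    ((hB 1 le_rfl le_rfl).elim _ _) (add_comm 1 0)
  obtain ⟨f, rfl⟩ := (Abelian.Ext.mk₀_bijective _ _).2 y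
  obtain ⟨g, hg⟩ := hext f.hom
  have hf : f = ModuleCat.ofHom i ≫ ModuleCat.ofHom g := ModuleCat.hom_ext hg.symm
  have := (shortExact_shortComplexOfExact hi h hp).extClass_comp_assoc
    (Abelian.Ext.mk₀ (ModuleCat.ofHom g)) (h := (rfl : 1 + 0 = 1))
  rwa [Abelian.Ext.mk₀_comp_mk₀, ← hf] at this

theorem hasProjectiveDimensionLT_right (hi : Function.Injective i) (h : Function.Exact i p)
    (hp : Function.Surjective p) {k : ℕ} (hA : HasProjectiveDimensionLT (ModuleCat.of S A) k)
    [hB : Module.Projective S B] : HasProjectiveDimensionLT (ModuleCat.of S C) (k + 1) := by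
  have : Projective (ModuleCat.of S B) := (IsProjective.iff_projective B).1 hB
  exact (shortExact_shortComplexOfExact hi h hp).hasProjectiveDimensionLT_X₃ k hA
    (hasProjectiveDimensionLT_of_ge _ 1 _ (by lia))

theorem hasProjectiveDimensionLT_mid (hi : Function.Injective i) (h : Function.Exact i p)
    (hp : Function.Surjective p) {k : ℕ}
    (hA : HasProjectiveDimensionLT (ModuleCat.of S A) (k + 1)) [hC : Module.Projective S C] :
    HasProjectiveDimensionLT (ModuleCat.of S B) (k + 1) := by
  have : Projective (ModuleCat.of S C) := (IsProjective.iff_projective C).1 hC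
  exact (shortExact_shortComplexOfExact hi h hp).hasProjectiveDimensionLT_X₂ _ hA
    (hasProjectiveDimensionLT_of_ge _ 1 _ (by lia))

theorem projective_of_hasProjectiveDimensionLE_zero
    (hA : HasProjectiveDimensionLE (ModuleCat.of S A) 0) : Module.Projective S A :=
  (IsProjective.iff_projective A).2 ((projective_iff_hasProjectiveDimensionLE_zero _).2 hA)

theorem hasProjectiveDimensionLE_of_projective [hA : Module.Projective S A] (k : ℕ) :
    HasProjectiveDimensionLE (ModuleCat.of S A) k := by
  have : Projective (ModuleCat.of S A) := (IsProjective.iff_projective A).1 hA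
  exact hasProjectiveDimensionLT_of_ge _ 1 _ (by lia)

/-- A finitely generated module of projective dimension at most `k` is a quotient of a finitely
generated projective module such that the kernel has projective dimension less than `k`. -/
theorem exists_projective_resolution_step [IsNoetherianRing S] [Module.Finite S A] {k : ℕ}
    (hA : HasProjectiveDimensionLE (ModuleCat.of S A) k) :
    ∃ (Z P : ModuleCat.{u} S) (j : Z →ₗ[S] P) (q : P →ₗ[S] A), Module.Finite S Z ∧
      Module.Finite S P ∧ Module.Projective S P ∧ Function.Injective j ∧ Function.Exact j q ∧
      Function.Surjective q ∧ HasProjectiveDimensionLT (ModuleCat.of S Z) k := by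
  obtain _ | k := k
  -- Projective dimension less than 0 forces the kernel to be zero, so `A` must cover itself.
  · have := projective_of_hasProjectiveDimensionLE_zero hA
    refine ⟨ModuleCat.of S PUnit.{u + 1}, ModuleCat.of S A, 0, LinearMap.id,
      inferInstanceAs (Module.Finite S PUnit.{u + 1}), ‹_›, this, Function.injective_of_subsingleton _,
      fun x => ?_, Function.surjective_id,
      (ModuleCat.isZero_of_subsingleton _).hasProjectiveDimensionLT_zero⟩
    simp [eq_comm]
  · obtain ⟨m, p, hp⟩ := Module.Finite.exists_fin' S A
    have hP : Projective (ModuleCat.of S (Fin m → S)) :=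
      (IsProjective.iff_projective _).1 inferInstance
    exact ⟨ModuleCat.of S (LinearMap.ker p), ModuleCat.of S (Fin m → S),
      (LinearMap.ker p).subtype, p, inferInstanceAs (Module.Finite _ (LinearMap.ker p)),
      inferInstanceAs (Module.Finite _ (Fin m → S)),
      inferInstanceAs (Module.Projective _ (Fin m → S)), Subtype.val_injective,
      LinearMap.exact_subtype_ker_map p, hp,
      (shortExact_shortComplexOfExact Subtype.val_injective (LinearMap.exact_subtype_ker_map p)
        hp).hasProjectiveDimensionLT_X₁ (k + 1)
        (hasProjectiveDimensionLT_of_ge _ 1 _ (by lia)) hA⟩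

end ExtVanishing

open MulOpposite

/-! ### Dual bases, reflexivity of projectives, torsionless modules. -/

section Duality

variable {Λ : Type u} [Ring Λ]

variable {Q M N P : Type u} [AddCommGroup Q] [Module Λᵐᵒᵖ Q] [AddCommGroup M] [Module Λᵐᵒᵖ M]
  [AddCommGroup N] [Module Λᵐᵒᵖ N] [AddCommGroup P] [Module Λᵐᵒᵖ P]

variable (Λ) in
/-- The homomorphism `Λ^k → Q` sending the `i`-th basis vector to `x i`. -/
def freeLift {k : ℕ} (x : Fin k → Q) : (Fin k → Λ) →ₗ[Λᵐᵒᵖ] Q where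
  toFun a := ∑ i, op (a i) • x i
  map_add' a b := by simp [add_smul, Finset.sum_add_distrib]
  map_smul' a b := by
    induction a using MulOpposite.rec'
    simp [mul_smul, Finset.smul_sum]

theorem freeLift_apply {k : ℕ} (x : Fin k → Q) (a : Fin k → Λ) :
    freeLift Λ x a = ∑ i, op (a i) • x i := rfl

theorem freeLift_surjective {k : ℕ} {x : Fin k → Q} (hx : Submodule.span Λᵐᵒᵖ (Set.range x) = ⊤) :
    Function.Surjective (freeLift Λ x) := by
  intro q
  obtain ⟨c, hc⟩ := (Submodule.mem_span_range_iff_exists_fun Λᵐᵒᵖ).1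
    (hx ▸ Submodule.mem_top : q ∈ Submodule.span Λᵐᵒᵖ (Set.range x))
  exact ⟨fun i => unop (c i), by simpa [freeLift_apply] using hc⟩

theorem exists_freeLift_surjective (Q : Type u) [AddCommGroup Q] [Module Λᵐᵒᵖ Q]
    [Module.Finite Λᵐᵒᵖ Q] :
    ∃ (k : ℕ) (x : Fin k → Q), Function.Surjective (freeLift Λ x) := by
  obtain ⟨k, x, hx⟩ := Module.Finite.exists_fin (R := Λᵐᵒᵖ) (M := Q)
  exact ⟨k, x, freeLift_surjective hx⟩

/-- The dual basis lemma: generators `x i` and functionals `f i` with `q = ∑ x i · f i q`. -/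
theorem exists_dual_basis (Q : Type u) [AddCommGroup Q] [Module Λᵐᵒᵖ Q] [Module.Finite Λᵐᵒᵖ Q]
    [Module.Projective Λᵐᵒᵖ Q] :
    ∃ (k : ℕ) (x : Fin k → Q) (f : Fin k → Dual Λ Q), ∀ q, ∑ i, op (f i q) • x i = q := by
  obtain ⟨k, x, hx⟩ := exists_freeLift_surjective (Λ := Λ) Q
  obtain ⟨g, hg⟩ := Module.projective_lifting_property (freeLift Λ x) LinearMap.id hx
  exact ⟨k, x, fun i => (LinearMap.proj i).comp g, fun q => LinearMap.congr_fun hg q⟩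

theorem dual_eq_sum {k : ℕ} {x : Fin k → Q} {f : Fin k → Dual Λ Q}
    (h : ∀ q, ∑ i, op (f i q) • x i = q) (g : Dual Λ Q) : ∑ i, g (x i) • f i = g := by
  ext q
  conv_rhs => rw [← h q, map_sum]
  simp

theorem projective_dual [Module.Finite Λᵐᵒᵖ Q] [Module.Projective Λᵐᵒᵖ Q] :
    Module.Projective Λ (Dual Λ Q) := by
  obtain ⟨k, x, f, h⟩ := exists_dual_basis (Λ := Λ) Q
  refine Module.Projective.of_split (P := Dual Λ Q) (M := Fin k → Λ)
    { toFun := fun g i => g (x i), map_add' := fun _ _ => rfl, map_smul' := fun _ _ => rfl }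
    (Fintype.linearCombination Λ f) ?_
  ext1 g
  simpa [Fintype.linearCombination_apply] using dual_eq_sum h g

theorem eval_bijective [Module.Finite Λᵐᵒᵖ Q] [Module.Projective Λᵐᵒᵖ Q] :
    Function.Bijective (eval Λ Q) := by
  obtain ⟨k, x, f, h⟩ := exists_dual_basis (Λ := Λ) Q
  refine ⟨fun y z hyz => ?_, fun φ => ⟨∑ i, op (φ (f i)) • x i, ?_⟩⟩
  · rw [← h y, ← h z]
    exact Finset.sum_congr rfl fun i _ => by rw [show f i y = f i z from LinearMap.congr_fun hyz _]
  · ext g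
    change g _ = _
    conv_rhs => rw [← dual_eq_sum h g]
    simp

theorem isTorsionless_iff :
    IsTorsionless Λ M ↔ ∀ x : M, (∀ f : Dual Λ M, f x = 0) → x = 0 := by
  rw [IsTorsionless, injective_iff_map_eq_zero]
  exact forall_congr' fun x => imp_congr_left LinearMap.ext_iff

theorem IsTorsionless.of_injective (hN : IsTorsionless Λ N) (i : M →ₗ[Λᵐᵒᵖ] N)
    (hi : Function.Injective i) : IsTorsionless Λ M :=
  isTorsionless_iff.2 fun _ hx => (map_eq_zero_iff i hi).1
    (isTorsionless_iff.1 hN _ fun f => hx (f.comp i))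

theorem IsTorsionless.prod (hM : IsTorsionless Λ M) (hN : IsTorsionless Λ N) :
    IsTorsionless Λ (M × N) :=
  isTorsionless_iff.2 fun _ hx => Prod.ext
    (isTorsionless_iff.1 hM _ fun f => hx (f.comp (LinearMap.fst _ _ _)))
    (isTorsionless_iff.1 hN _ fun f => hx (f.comp (LinearMap.snd _ _ _)))

theorem isTorsionless_of_projective [Module.Finite Λᵐᵒᵖ Q] [Module.Projective Λᵐᵒᵖ Q] :
    IsTorsionless Λ Q := eval_bijective.1

/-- A dual basis of `Q` reduces the extension problem to its finitely many coordinates, which are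
functionals on `M`. -/
theorem exists_extension_of_dual (s : M →ₗ[Λᵐᵒᵖ] P) (hs : Function.Surjective (dualMap Λ s))
    [Module.Finite Λᵐᵒᵖ Q] [Module.Projective Λᵐᵒᵖ Q] (g : M →ₗ[Λᵐᵒᵖ] Q) :
    ∃ h : P →ₗ[Λᵐᵒᵖ] Q, h.comp s = g := by
  obtain ⟨k, x, f, hf⟩ := exists_dual_basis (Λ := Λ) Q
  choose e he using fun i => hs ((f i).comp g)
  refine ⟨(freeLift Λ x).comp (LinearMap.pi e), ?_⟩
  ext m
  have (i : Fin k) : e i (s m) = f i (g m) := LinearMap.congr_fun (he i) m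
  simp [freeLift_apply, this, hf]

variable (Λ) in
/-- Transport of coordinates from `Λᵐᵒᵖ` to `Λ`, both as right modules. -/
def freeUnop (k : ℕ) : (Fin k → Λᵐᵒᵖ) ≃ₗ[Λᵐᵒᵖ] (Fin k → Λ) :=
  LinearEquiv.piCongrRight fun _ => { MulOpposite.opAddEquiv.symm with map_smul' := fun _ _ => rfl }

theorem free_projective (k : ℕ) : Module.Projective Λᵐᵒᵖ (Fin k → Λ) :=
  Module.Projective.of_equiv (freeUnop Λ k)

theorem free_finite (k : ℕ) : Module.Finite Λᵐᵒᵖ (Fin k → Λ) :=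
  Module.Finite.equiv (freeUnop Λ k)

/-- Values on generators embed the dual into a free left module of finite rank; this is where left
noetherianness enters. -/
theorem finite_dual [IsNoetherianRing Λ] [Module.Finite Λᵐᵒᵖ M] :
    Module.Finite Λ (Dual Λ M) := by
  obtain ⟨k, x, hx⟩ := exists_freeLift_surjective (Λ := Λ) M
  let r : Dual Λ M →ₗ[Λ] (Fin k → Λ) :=
    { toFun := fun g i => g (x i), map_add' := fun _ _ => rfl, map_smul' := fun _ _ => rfl }
  refine Module.Finite.of_injective r fun f g hfg => ?_
  ext m
  obtain ⟨a, rfl⟩ := hx m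
  have (i : Fin k) : f (x i) = g (x i) := congrFun hfg i
  simp [freeLift_apply, this]

/-- Over a noetherian ring, every finitely generated module has a homomorphism to a finitely
generated projective module whose dual is surjective. -/
theorem exists_dualMap_surjective [IsNoetherianRing Λ] (M : Type u) [AddCommGroup M]
    [Module Λᵐᵒᵖ M] [Module.Finite Λᵐᵒᵖ M] :
    ∃ (P : ModuleCat.{u} Λᵐᵒᵖ) (s : M →ₗ[Λᵐᵒᵖ] P), Module.Finite Λᵐᵒᵖ P ∧
      Module.Projective Λᵐᵒᵖ P ∧ Function.Surjective (dualMap Λ s) := by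
  have := finite_dual (Λ := Λ) (M := M)
  obtain ⟨k, f, hf⟩ := Module.Finite.exists_fin (R := Λ) (M := Dual Λ M)
  refine ⟨ModuleCat.of Λᵐᵒᵖ (Fin k → Λ), LinearMap.pi f, free_finite k, free_projective k,
    fun g => ?_⟩
  obtain ⟨c, hc⟩ := (Submodule.mem_span_range_iff_exists_fun Λ).1
    (hf ▸ Submodule.mem_top : g ∈ Submodule.span Λ (Set.range f))
  refine ⟨∑ i, c i • LinearMap.proj i, ?_⟩
  rw [← hc]
  ext m
  simp [dualMap]

theorem injective_of_dualMap_surjective (hM : IsTorsionless Λ M) (s : M →ₗ[Λᵐᵒᵖ] P)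
    (hs : Function.Surjective (dualMap Λ s)) : Function.Injective s := by
  refine (injective_iff_map_eq_zero s).2 fun x hx => isTorsionless_iff.1 hM x fun f => ?_
  obtain ⟨g, rfl⟩ := hs f
  simp [dualMap, hx]

end Duality

/-! ### Torsionfreeness as existence of dual-exact coresolutions. -/

section Torsionfree

variable (Λ : Type u) [Ring Λ]

/-- `M` has a coresolution of length `k` by finitely generated projective modules that stays exact
under `Λ`-duality. -/
def HasProjCoresolution : (k : ℕ) → (M : Type u) → [AddCommGroup M] → [Module Λᵐᵒᵖ M] → Prop
  | 0, _, _, _ => True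
  | k + 1, M, _, _ =>
    ∃ (P N : ModuleCat.{u} Λᵐᵒᵖ) (s : M →ₗ[Λᵐᵒᵖ] P) (p : P →ₗ[Λᵐᵒᵖ] N),
      IsShortExact Λ s p ∧ Module.Projective Λᵐᵒᵖ P ∧ ExtVanishes Λᵐᵒᵖ N Λ 1 ∧
      HasProjCoresolution k N

variable {Λ} {M N P : Type u} [AddCommGroup M] [Module Λᵐᵒᵖ M] [AddCommGroup N] [Module Λᵐᵒᵖ N]
  [AddCommGroup P] [Module Λᵐᵒᵖ P]

theorem isShortExact_coker [IsNoetherianRing Λᵐᵒᵖ] [Module.Finite Λᵐᵒᵖ P] {s : M →ₗ[Λᵐᵒᵖ] P}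
    (hs : Function.Injective s) : IsShortExact Λ s (LinearMap.range s).mkQ where
  finite_left := Module.Finite.of_injective s hs
  finite_mid := ‹_›
  finite_right := inferInstance
  injective := hs
  exact := LinearMap.exact_map_mkQ_range s
  surjective := Submodule.mkQ_surjective _

theorem IsShortExact.extVanishes_one_iff {s : M →ₗ[Λᵐᵒᵖ] P} {p : P →ₗ[Λᵐᵒᵖ] N}
    (h : IsShortExact Λ s p) [Module.Projective Λᵐᵒᵖ P] :
    ExtVanishes Λᵐᵒᵖ N Λ 1 ↔ Function.Surjective (dualMap Λ s) :=
  ⟨fun hN => hN.exists_extension h.injective h.exact h.surjective,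
    extVanishes_one_of_extension h.injective h.exact h.surjective (extVanishes_of_projective 1)⟩

theorem hasProjCoresolution_one_iff [IsNoetherianRing Λ] [IsNoetherianRing Λᵐᵒᵖ]
    [Module.Finite Λᵐᵒᵖ M] : HasProjCoresolution Λ 1 M ↔ IsTorsionless Λ M := by
  constructor
  · rintro ⟨P, N, s, p, hsp, hP, -, -⟩
    have := hsp.finite_mid
    exact isTorsionless_of_projective.of_injective s hsp.injective
  · intro hM
    obtain ⟨P, s, hPf, hP, hs⟩ := exists_dualMap_surjective (Λ := Λ) M
    have hsp := isShortExact_coker (injective_of_dualMap_surjective hM s hs)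
    exact ⟨P, ModuleCat.of _ (P ⧸ LinearMap.range s), s, _, hsp, hP,
      hsp.extVanishes_one_iff.2 hs, trivial⟩

/-- The summand `P` is absorbed by the first projective term, so the cokernel is unchanged. -/
theorem HasProjCoresolution.prod {k : ℕ} (hM : HasProjCoresolution Λ k M) [Module.Finite Λᵐᵒᵖ P]
    [Module.Projective Λᵐᵒᵖ P] : HasProjCoresolution Λ k (M × P) := by
  obtain _ | k := k
  · trivial
  · obtain ⟨Q, N, s, p, hsp, hQ, hN, hk⟩ := hM
    have := hsp.finite_left
    have := hsp.finite_mid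
    refine ⟨ModuleCat.of _ (Q × P), N, s.prodMap LinearMap.id, p.comp (LinearMap.fst _ _ _),
      ⟨inferInstance, inferInstanceAs (Module.Finite Λᵐᵒᵖ (Q × P)), hsp.finite_right, ?_, ?_, ?_⟩,
      inferInstanceAs (Module.Projective Λᵐᵒᵖ (Q × P)), hN, hk⟩
    · exact hsp.injective.prodMap Function.injective_id
    · rintro ⟨q, x⟩
      refine (hsp.exact q).trans ⟨?_, ?_⟩
      · rintro ⟨m, rfl⟩
        exact ⟨(m, x), rfl⟩
      · rintro ⟨⟨m, y⟩, h⟩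
        exact ⟨m, congrArg Prod.fst h⟩
    · exact hsp.surjective.comp Prod.fst_surjective

theorem exists_comp_eq_of_ker_le {S A B C : Type*} [Ring S] [AddCommGroup A] [Module S A]
    [AddCommGroup B] [Module S B] [AddCommGroup C] [Module S C] {p : A →ₗ[S] B}
    (hp : Function.Surjective p) (g : A →ₗ[S] C) (h : ∀ x, p x = 0 → g x = 0) :
    ∃ g' : B →ₗ[S] C, ∀ x, g' (p x) = g x := by
  have hle : LinearMap.ker p ≤ LinearMap.ker g := fun x hx => h x hx
  refine ⟨((LinearMap.ker p).liftQ g hle).comp (p.quotKerEquivOfSurjective hp).symm.toLinearMap,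
    fun x => ?_⟩
  have : (p.quotKerEquivOfSurjective hp).symm (p x) = Submodule.Quotient.mk x :=
    (LinearEquiv.symm_apply_eq _).2 rfl
  rw [LinearMap.comp_apply, LinearEquiv.coe_coe, this, Submodule.liftQ_apply]

theorem exists_dual_factorization {P₁ P₀ : Type u} [AddCommGroup P₁] [Module Λᵐᵒᵖ P₁]
    [AddCommGroup P₀] [Module Λᵐᵒᵖ P₀] {d : P₁ →ₗ[Λᵐᵒᵖ] P₀} {p : P₀ →ₗ[Λᵐᵒᵖ] M}
    (hdp : Function.Exact d p) (hp : Function.Surjective p) {g : Dual Λ P₀}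
    (hg : dualMap Λ d g = 0) : ∃ g' : Dual Λ M, g'.comp p = g := by
  obtain ⟨g', hg'⟩ := exists_comp_eq_of_ker_le hp g fun z hz => by
    obtain ⟨x, rfl⟩ := (hdp z).1 hz
    exact LinearMap.congr_fun hg x
  exact ⟨g', LinearMap.ext hg'⟩

/-! ### Syzygies of the transpose; here `B` is the image of `d^*`. -/

section Transpose

variable {P₁ P₀ T B : Type u} [AddCommGroup P₁] [Module Λᵐᵒᵖ P₁] [AddCommGroup P₀]
  [Module Λᵐᵒᵖ P₀] [AddCommGroup T] [Module Λ T] [AddCommGroup B] [Module Λ B]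
  {d : P₁ →ₗ[Λᵐᵒᵖ] P₀} {p : P₀ →ₗ[Λᵐᵒᵖ] M} {q : Dual Λ P₁ →ₗ[Λ] T}
  {b : Dual Λ P₀ →ₗ[Λ] B} {j : B →ₗ[Λ] Dual Λ P₁}
  [Module.Finite Λᵐᵒᵖ P₀] [Module.Projective Λᵐᵒᵖ P₀]

/-- `M` is torsionless if and only if `Ext¹(Tr M, Λ)` vanishes. -/
theorem extVanishes_one_transpose_iff [Module.Finite Λᵐᵒᵖ P₁] [Module.Projective Λᵐᵒᵖ P₁]
    (hdp : Function.Exact d p) (hp : Function.Surjective p)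
    (hb : Function.Surjective b) (hj : Function.Injective j) (hbj : ∀ g, j (b g) = g.comp d)
    (hjq : Function.Exact j q) (hq : Function.Surjective q) :
    ExtVanishes Λ T Λ 1 ↔ IsTorsionless Λ M := by
  have := projective_dual (Λ := Λ) (Q := P₁)
  constructor
  · refine fun hT => isTorsionless_iff.2 fun m hm => ?_
    obtain ⟨y, rfl⟩ := hp m
    -- Evaluation at `y` descends to `B`: functionals killed by `b` come from the dual of `M`, and
    -- those vanish at `p y`. Its extension to the dual of `P₁` is evaluation at some `x`, and then
    -- `y = d x`.
    obtain ⟨f, hf⟩ := exists_comp_eq_of_ker_le hb (eval Λ P₀ y) fun g hg => by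
      obtain ⟨g', rfl⟩ := exists_dual_factorization hdp hp (g := g)
        ((hbj g).symm.trans (by rw [hg, map_zero]))
      exact hm g'
    obtain ⟨φ, hφ⟩ := hT.exists_extension hj hjq hq f
    obtain ⟨x, rfl⟩ := eval_bijective.2 φ
    refine (hdp y).2 ⟨x, (eval_bijective (Λ := Λ)).1 (LinearMap.ext fun g => ?_)⟩
    rw [← hf, ← hφ, LinearMap.comp_apply, hbj]
    rfl
  · refine fun hM => extVanishes_one_of_extension hj hjq hq (extVanishes_of_projective 1)
      fun f => ?_
    obtain ⟨y, hy⟩ := (eval_bijective (Λ := Λ) (Q := P₀)).2 (f ∘ₗ b)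
    have hpy : p y = 0 := isTorsionless_iff.1 hM _ fun g => by
      have h0 : b (g.comp p) = 0 := hj <| by
        rw [hbj, map_zero]
        ext x
        simp [hdp.apply_apply_eq_zero]
      have := LinearMap.congr_fun hy (g.comp p)
      rw [LinearMap.comp_apply, h0, map_zero] at this
      exact this
    obtain ⟨x, rfl⟩ := (hdp y).1 hpy
    refine ⟨eval Λ P₁ x, LinearMap.ext fun z => ?_⟩
    obtain ⟨g, rfl⟩ := hb z
    rw [LinearMap.comp_apply, hbj]
    exact LinearMap.congr_fun hy g

/-- Use the presentation `P₀ → P → N → 0` through `s ∘ p`. Since `s^*` is surjective, the image of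
`P^*` in `P₀^*` is that of `M^*`, namely the kernel of `d^*`; the cokernel is therefore the image of
`d^*`. -/
theorem isTranspose_of_factorization
    (hdp : Function.Exact d p) (hp : Function.Surjective p)
    (hb : Function.Surjective b) (hj : Function.Injective j) (hbj : ∀ g, j (b g) = g.comp d)
    {s : M →ₗ[Λᵐᵒᵖ] P} {r : P →ₗ[Λᵐᵒᵖ] N} (h : IsShortExact Λ s r) [Module.Projective Λᵐᵒᵖ P]
    (hs : Function.Surjective (dualMap Λ s)) :
    IsTranspose Λ N B := by
  refine ⟨ModuleCat.of _ P₀, ModuleCat.of _ P, s.comp p, r, b, ‹_›, ‹_›,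
    h.finite_mid, ‹_›, fun y => ?_, h.surjective, fun g => ?_, hb⟩
  · rw [h.exact y]
    exact ⟨fun ⟨m, hm⟩ => (hp m).imp fun z hz => by simp [hz, hm], fun ⟨z, hz⟩ => ⟨p z, hz⟩⟩
  · constructor
    · intro hg
      obtain ⟨g', rfl⟩ := exists_dual_factorization hdp hp (g := g)
        ((hbj g).symm.trans (by rw [hg, map_zero]))
      obtain ⟨f, rfl⟩ := hs g'
      exact ⟨f, rfl⟩
    · rintro ⟨f, rfl⟩
      refine hj ?_
      rw [hbj, map_zero]
      refine LinearMap.ext fun x => ?_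
      change f (s (p (d x))) = 0
      rw [hdp.apply_apply_eq_zero, map_zero, map_zero]

end Transpose

/-- Vanishing of `Ext` on a transpose is equivalent to the existence of a coresolution by
projectives that is exact under duality. -/
theorem extVanishes_transpose_iff [IsNoetherianRing Λ] [IsNoetherianRing Λᵐᵒᵖ] (k : ℕ)
    {M T : Type u} [AddCommGroup M] [Module Λᵐᵒᵖ M] [AddCommGroup T] [Module Λ T]
    (hT : IsTranspose Λ M T) : ExtVanishes Λ T Λ k ↔ HasProjCoresolution Λ k M := by
  induction k generalizing M T with
  | zero => exact ⟨fun _ => trivial, fun _ => extVanishes_zero⟩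
  | succ k ih =>
    obtain ⟨P₁, P₀, d, p, q, hP₁f, hP₁, hP₀f, hP₀, hdp, hp, hdq, hq⟩ := hT
    have := projective_dual (Λ := Λ) (Q := P₁)
    have hMf : Module.Finite Λᵐᵒᵖ M := Module.Finite.of_surjective p hp
    obtain ⟨B, b, j, hb, hj, hbj, hjq⟩ : ∃ (B : ModuleCat.{u} Λ) (b : Dual Λ P₀ →ₗ[Λ] B)
        (j : B →ₗ[Λ] Dual Λ P₁), Function.Surjective b ∧ Function.Injective j ∧
        (∀ g, j (b g) = g.comp d) ∧ Function.Exact j q :=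
      ⟨ModuleCat.of Λ (LinearMap.range (dualMap Λ d)), (dualMap Λ d).rangeRestrict,
        (LinearMap.range (dualMap Λ d)).subtype, LinearMap.surjective_rangeRestrict _,
        Subtype.val_injective, fun _ => rfl,
        fun y => (hdq y).trans ⟨fun h => ⟨⟨y, h⟩, rfl⟩, fun ⟨z, hz⟩ => hz ▸ z.2⟩⟩
    have h1 := extVanishes_one_transpose_iff hdp hp hb hj hbj hjq hq
    constructor
    · intro hT
      have hM := h1.1 (hT.mono (by lia))
      obtain ⟨P, s, hPf, hP, hs⟩ := exists_dualMap_surjective (Λ := Λ) M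
      have hsr := isShortExact_coker (injective_of_dualMap_surjective hM s hs)
      refine ⟨P, ModuleCat.of _ (P ⧸ LinearMap.range s), s, _, hsr, hP,
        hsr.extVanishes_one_iff.2 hs, ?_⟩
      -- `B` is both a syzygy of `T` and a transpose of the cokernel of `s`, so shifting costs one
      -- degree and one coresolution step.
      exact (ih (isTranspose_of_factorization hdp hp hb hj hbj hsr hs)).1
        (ExtVanishes.left hj hjq hq (extVanishes_of_projective k) hT)
    · rintro ⟨P, N, s, r, hsr, hP, hN, hk⟩
      have hs := hsr.extVanishes_one_iff.1 hN
      have hPf := hsr.finite_mid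
      exact ExtVanishes.right hj hjq hq
        ((ih (isTranspose_of_factorization hdp hp hb hj hbj hsr hs)).2 hk)
        (extVanishes_of_projective _)
        (h1.2 (isTorsionless_of_projective.of_injective s hsr.injective))

theorem isTorsionfree_iff [IsNoetherianRing Λ] [IsNoetherianRing Λᵐᵒᵖ] [Module.Finite Λᵐᵒᵖ M]
    (k : ℕ) : IsTorsionfree Λ k M ↔ HasProjCoresolution Λ k M := by
  obtain ⟨T, hT⟩ := exists_isTranspose Λ M
  exact ⟨fun h => (extVanishes_transpose_iff k hT).1 (h T hT),
    fun h T _ _ hT => (extVanishes_transpose_iff k hT).2 h⟩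

end Torsionfree

/-! ### Pullbacks of short exact sequences. -/

section Approximation

variable {Λ : Type u} [Ring Λ] {L M N P W X Y Z : Type u}
  [AddCommGroup L] [Module Λᵐᵒᵖ L] [AddCommGroup M] [Module Λᵐᵒᵖ M]
  [AddCommGroup N] [Module Λᵐᵒᵖ N] [AddCommGroup P] [Module Λᵐᵒᵖ P]
  [AddCommGroup W] [Module Λᵐᵒᵖ W] [AddCommGroup X] [Module Λᵐᵒᵖ X]
  [AddCommGroup Y] [Module Λᵐᵒᵖ Y] [AddCommGroup Z] [Module Λᵐᵒᵖ Z]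

/-- The pullback of `f` and `g`. -/
abbrev Pullback (f : W →ₗ[Λᵐᵒᵖ] M) (g : N →ₗ[Λᵐᵒᵖ] M) : Submodule Λᵐᵒᵖ (W × N) :=
  LinearMap.eqLocus (f.comp (LinearMap.fst _ _ _)) (g.comp (LinearMap.snd _ _ _))

/-- The map from the kernel of `f` to the pullback of `f` and `g`. -/
def pullbackInl (f : W →ₗ[Λᵐᵒᵖ] M) (g : N →ₗ[Λᵐᵒᵖ] M) {i : Z →ₗ[Λᵐᵒᵖ] W}
    (h : Function.Exact i f) : Z →ₗ[Λᵐᵒᵖ] Pullback f g :=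
  ((LinearMap.inl _ _ _).comp i).codRestrict _ fun z => by simp [h.apply_apply_eq_zero]

/-- The map from the kernel of `g` to the pullback of `f` and `g`. -/
def pullbackInr (f : W →ₗ[Λᵐᵒᵖ] M) (g : N →ₗ[Λᵐᵒᵖ] M) {i : Z →ₗ[Λᵐᵒᵖ] N}
    (h : Function.Exact i g) : Z →ₗ[Λᵐᵒᵖ] Pullback f g :=
  ((LinearMap.inr _ _ _).comp i).codRestrict _ fun z => by simp [h.apply_apply_eq_zero]

/-- The first projection of a pullback. -/
def pullbackFst (f : W →ₗ[Λᵐᵒᵖ] M) (g : N →ₗ[Λᵐᵒᵖ] M) : Pullback f g →ₗ[Λᵐᵒᵖ] W :=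
  (LinearMap.fst _ _ _).comp (Submodule.subtype _)

/-- The second projection of a pullback. -/
def pullbackSnd (f : W →ₗ[Λᵐᵒᵖ] M) (g : N →ₗ[Λᵐᵒᵖ] M) : Pullback f g →ₗ[Λᵐᵒᵖ] N :=
  (LinearMap.snd _ _ _).comp (Submodule.subtype _)

theorem IsShortExact.pullback_left [IsNoetherianRing Λᵐᵒᵖ] [Module.Finite Λᵐᵒᵖ N]
    {i : Z →ₗ[Λᵐᵒᵖ] W} {f : W →ₗ[Λᵐᵒᵖ] M} (h : IsShortExact Λ i f) (g : N →ₗ[Λᵐᵒᵖ] M) :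
    IsShortExact Λ (pullbackInl f g h.exact) (pullbackSnd f g) where
  finite_left := h.finite_left
  finite_mid := by
    have := h.finite_mid
    infer_instance
  finite_right := ‹_›
  injective x y hxy := h.injective (congrArg (fun e => e.1.1) hxy)
  exact := by
    rintro ⟨⟨w, x⟩, hwx⟩
    constructor
    · rintro (rfl : x = 0)
      obtain ⟨z, rfl⟩ := (h.exact w).1 (by simpa using hwx)
      exact ⟨z, rfl⟩
    · rintro ⟨z, hz⟩
      exact (congrArg (fun e => e.1.2) hz).symm
  surjective x := by
    obtain ⟨w, hw⟩ := h.surjective (g x)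
    exact ⟨⟨(w, x), hw⟩, rfl⟩

theorem IsShortExact.pullback_right [IsNoetherianRing Λᵐᵒᵖ] [Module.Finite Λᵐᵒᵖ W]
    {i : Z →ₗ[Λᵐᵒᵖ] N} {g : N →ₗ[Λᵐᵒᵖ] M} (h : IsShortExact Λ i g) (f : W →ₗ[Λᵐᵒᵖ] M) :
    IsShortExact Λ (pullbackInr f g h.exact) (pullbackFst f g) where
  finite_left := h.finite_left
  finite_mid := by
    have := h.finite_mid
    infer_instance
  finite_right := ‹_›
  injective x y hxy := h.injective (congrArg (fun e => e.1.2) hxy)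
  exact := by
    rintro ⟨⟨w, x⟩, hwx⟩
    constructor
    · rintro (rfl : w = 0)
      obtain ⟨z, rfl⟩ := (h.exact x).1 (by simpa [eq_comm] using hwx)
      exact ⟨z, rfl⟩
    · rintro ⟨z, hz⟩
      exact (congrArg (fun e => e.1.1) hz).symm
  surjective w := by
    obtain ⟨x, hx⟩ := h.surjective (f w)
    exact ⟨⟨(w, x), hx.symm⟩, rfl⟩

/-! ### The pushout of an AB approximation. -/

section Hull

variable {n : ℕ} {i : Z →ₗ[Λᵐᵒᵖ] W} {f : W →ₗ[Λᵐᵒᵖ] M} {s : W →ₗ[Λᵐᵒᵖ] P}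

theorem isShortExact_prod [IsNoetherianRing Λᵐᵒᵖ] [Module.Finite Λᵐᵒᵖ M] [Module.Finite Λᵐᵒᵖ P]
    (f : W →ₗ[Λᵐᵒᵖ] M) (hs : Function.Injective s) :
    IsShortExact Λ (f.prod s) (LinearMap.range (f.prod s)).mkQ :=
  isShortExact_coker fun _ _ h => hs (congrArg Prod.snd h)

theorem isShortExact_fromM_toCoker [IsNoetherianRing Λᵐᵒᵖ] [Module.Finite Λᵐᵒᵖ M]
    [Module.Finite Λᵐᵒᵖ P] (f : W →ₗ[Λᵐᵒᵖ] M) (hs : Function.Injective s) :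
    IsShortExact Λ (fromM Λ f s) (toCoker Λ f s) where
  finite_left := ‹_›
  finite_mid := inferInstance
  finite_right := inferInstance
  injective := by
    refine (injective_iff_map_eq_zero _).2 fun m hm => ?_
    obtain ⟨w, hw⟩ := (Submodule.Quotient.mk_eq_zero _).1 hm
    have hw0 : w = 0 := (map_eq_zero_iff s hs).1 (congrArg Prod.snd hw)
    simpa [hw0] using (congrArg Prod.fst hw).symm
  exact y := by
    obtain ⟨⟨m, x⟩, rfl⟩ := Submodule.mkQ_surjective _ y
    constructor
    · intro h
      obtain ⟨w, hw⟩ := (Submodule.Quotient.mk_eq_zero _).1 (neg_eq_zero.1 h)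
      refine ⟨m - f w, (Submodule.Quotient.eq _).2 ⟨-w, ?_⟩⟩
      have hw : s w = x := hw
      simp [hw]
    · rintro ⟨m', hm⟩
      rw [← hm]
      exact LinearMap.congr_fun (pushout_comm Λ f s).2.1 m'
  surjective y := by
    obtain ⟨x, rfl⟩ := Submodule.mkQ_surjective _ y
    exact ⟨fromP Λ f s x, LinearMap.congr_fun (pushout_comm Λ f s).2.2 x⟩

/-- A pushout keeps the kernel of `f`. This presents the pushout as projective modulo `Z`, which
bounds its projective dimension. -/
theorem isShortExact_fromP [IsNoetherianRing Λᵐᵒᵖ] [Module.Finite Λᵐᵒᵖ M]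
    [Module.Finite Λᵐᵒᵖ P] (h : IsShortExact Λ i f) (hs : Function.Injective s) :
    IsShortExact Λ (s.comp i) (fromP Λ f s) where
  finite_left := h.finite_left
  finite_mid := ‹_›
  finite_right := inferInstance
  injective := hs.comp h.injective
  exact x := by
    constructor
    · intro hx
      obtain ⟨w, hw⟩ := (Submodule.Quotient.mk_eq_zero _).1 (neg_eq_zero.1 hx)
      obtain ⟨z, rfl⟩ := (h.exact w).1 (congrArg Prod.fst hw)
      exact ⟨z, congrArg Prod.snd hw⟩
    · rintro ⟨z, rfl⟩
      refine (LinearMap.congr_fun (pushout_comm Λ f s).1 (i z)).symm.trans ?_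
      rw [LinearMap.comp_apply, h.exact.apply_apply_eq_zero, map_zero]
  surjective y := by
    obtain ⟨⟨m, x⟩, rfl⟩ := Submodule.mkQ_surjective _ y
    obtain ⟨w, rfl⟩ := h.surjective m
    refine ⟨s w - x, ?_⟩
    change -(Submodule.Quotient.mk (0, s w - x)) = _
    rw [← Submodule.Quotient.mk_neg]
    refine (Submodule.Quotient.eq _).2 ⟨-w, ?_⟩
    simp

/-- The pushout of an `n`-AB approximation along an injection `s` into a projective module with
`s^*` surjective is an `n`-FPD hull. -/
theorem IsABApproximation.isFPDHull [IsNoetherianRing Λᵐᵒᵖ] [Module.Finite Λᵐᵒᵖ P]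
    [Module.Projective Λᵐᵒᵖ P] (h : IsABApproximation Λ n i f) (hs : Function.Injective s)
    (hs' : Function.Surjective (dualMap Λ s)) :
    IsFPDHull Λ n (fromM Λ f s) (toCoker Λ f s) := by
  have := h.shortExact.finite_right
  have hc := isShortExact_coker (Λ := Λ) hs
  have hp := isShortExact_fromP h.shortExact hs
  exact ⟨isShortExact_fromM_toCoker f hs,
    hasProjectiveDimensionLT_right hp.injective hp.exact hp.surjective h.pd,
    ExtVanishes.right hc.injective hc.exact hc.surjective h.ext (extVanishes_of_projective _)
      (hc.extVanishes_one_iff.2 hs')⟩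

theorem IsABApproximation.isOriginExtension [IsNoetherianRing Λᵐᵒᵖ] [Module.Finite Λᵐᵒᵖ P]
    [Module.Projective Λᵐᵒᵖ P] (h : IsABApproximation Λ n i f) (hs : Function.Injective s) :
    IsOriginExtension Λ n (f.prod s) (LinearMap.range (f.prod s)).mkQ := by
  have := h.shortExact.finite_right
  have hp := isShortExact_fromP h.shortExact hs
  exact ⟨isShortExact_prod f hs, ‹_›,
    hasProjectiveDimensionLT_right hp.injective hp.exact hp.surjective h.pd, h.ext⟩

theorem IsLeftProjApproximation.dualMap_surjective (h : IsLeftProjApproximation Λ s) :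
    Function.Surjective (dualMap Λ s) := by
  intro g
  -- A functional is a map into the free module of rank one.
  obtain ⟨l, hl⟩ := h.factors (Fin 1 → Λ) (free_finite 1) (free_projective 1)
    (LinearMap.pi fun _ => g)
  refine ⟨(LinearMap.proj 0).comp l, LinearMap.ext fun w => ?_⟩
  exact congrFun (LinearMap.congr_fun hl w).symm 0

end Hull

/-! ### Exchanges between hulls, AB approximations and syzygies. -/

variable (Λ) in
/-- `M` has an `n`-FPD hull `0 → M → Y → X → 0` such that `X` has a dual-exact projective
coresolution of length `m`. -/
def HasFPDHull (n m : ℕ) (M : Type u) [AddCommGroup M] [Module Λᵐᵒᵖ M] : Prop :=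
  ∃ (Y X : ModuleCat.{u} Λᵐᵒᵖ) (g : M →ₗ[Λᵐᵒᵖ] Y) (p : Y →ₗ[Λᵐᵒᵖ] X),
    IsFPDHull Λ n g p ∧ HasProjCoresolution Λ m X

variable (Λ) in
/-- `M` has an `n`-AB approximation `0 → Z → W → M → 0` such that `W` has a dual-exact projective
coresolution of length `m`. -/
def HasABApproximation (n m : ℕ) (M : Type u) [AddCommGroup M] [Module Λᵐᵒᵖ M] : Prop :=
  ∃ (Z W : ModuleCat.{u} Λᵐᵒᵖ) (i : Z →ₗ[Λᵐᵒᵖ] W) (f : W →ₗ[Λᵐᵒᵖ] M),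
    IsABApproximation Λ n i f ∧ HasProjCoresolution Λ m W

theorem HasABApproximation.hasFPDHull [IsNoetherianRing Λᵐᵒᵖ] {n m : ℕ}
    (h : HasABApproximation Λ n (m + 1) M) : HasFPDHull Λ n m M := by
  obtain ⟨Z, W, i, f, hf, P, N, s, p, hsp, hP, hN, hm⟩ := h
  have := hf.shortExact.finite_right
  have := hsp.finite_mid
  have hy := isShortExact_fromM_toCoker f hsp.injective
  have hp := isShortExact_fromP hf.shortExact hsp.injective
  -- `r` identifies the cokernel of `s` with the given `N`, whose coresolution is the one at hand.
  obtain ⟨r, hr⟩ := exists_comp_eq_of_ker_le (Submodule.mkQ_surjective (LinearMap.range s)) p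
    fun x hx => by
      obtain ⟨w, rfl⟩ := (Submodule.Quotient.mk_eq_zero _).1 hx
      exact hsp.exact.apply_apply_eq_zero w
  have hr_inj : Function.Injective r := by
    refine (injective_iff_map_eq_zero r).2 fun y hy => ?_
    obtain ⟨x, rfl⟩ := Submodule.mkQ_surjective _ y
    exact (Submodule.Quotient.mk_eq_zero _).2 ((hsp.exact x).1 ((hr x).symm.trans hy))
  have hr_surj : Function.Surjective r := fun y =>
    (hsp.surjective y).elim fun x hx => ⟨_, (hr x).trans hx⟩
  refine ⟨ModuleCat.of _ (PushoutCoker Λ f s), N, fromM Λ f s, r.comp (toCoker Λ f s),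
    ⟨⟨hy.finite_left, hy.finite_mid, hsp.finite_right, hy.injective, fun y => ?_,
      hr_surj.comp hy.surjective⟩,
    hasProjectiveDimensionLT_right hp.injective hp.exact hp.surjective hf.pd,
    ExtVanishes.right hsp.injective hsp.exact hsp.surjective hf.ext
      (extVanishes_of_projective _) hN⟩, hm⟩
  rw [LinearMap.comp_apply, map_eq_zero_iff r hr_inj]
  exact hy.exact y

theorem HasFPDHull.hasABApproximation [IsNoetherianRing Λᵐᵒᵖ] {n m : ℕ}
    (h : HasFPDHull Λ n m M) : HasABApproximation Λ n (m + 1) M := by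
  obtain ⟨Y, X, g, p, hg, hm⟩ := h
  have := hg.shortExact.finite_left
  have hYf := hg.shortExact.finite_mid
  obtain ⟨Z, P, j, q, hZ, hPf, hP, hj, hjq, hq, hpd⟩ := exists_projective_resolution_step hg.pd
  have hjq : IsShortExact Λ j q := ⟨hZ, hPf, hYf, hj, hjq, hq⟩
  have hw := hjq.pullback_left g
  -- The pullback is the preimage of `M` in `P`, hence the kernel of `P → X`; it inherits
  -- `Ext`-vanishing from `X` and a coresolution one step longer.
  have hs : IsShortExact Λ (pullbackFst q g) (p.comp q) := by
    refine ⟨hw.finite_mid, hPf, hg.shortExact.finite_right, ?_, fun x => ?_,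
      hg.shortExact.surjective.comp hq⟩
    · refine (injective_iff_map_eq_zero _).2 ?_
      rintro ⟨⟨x, m⟩, hx⟩ (rfl : x = 0)
      have hm : g m = 0 := by simpa [eq_comm] using hx
      have := (map_eq_zero_iff g hg.shortExact.injective).1 hm
      subst this
      rfl
    · refine (hg.shortExact.exact (q x)).trans ⟨?_, ?_⟩
      · rintro ⟨m, hm⟩
        exact ⟨⟨(x, m), hm.symm⟩, rfl⟩
      · rintro ⟨⟨⟨x, m⟩, hx⟩, rfl⟩
        exact ⟨m, hx.symm⟩
  exact ⟨Z, ModuleCat.of _ (Pullback q g), _, _, ⟨hw, hpd,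
    ExtVanishes.left hs.injective hs.exact hs.surjective (extVanishes_of_projective _) hg.ext⟩,
    P, X, _, _, hs, hP, hg.ext.mono (by lia), hm⟩

theorem hasFPDHull_iff [IsNoetherianRing Λᵐᵒᵖ] {n m : ℕ} :
    HasFPDHull Λ n m M ↔ HasABApproximation Λ n (m + 1) M :=
  ⟨HasFPDHull.hasABApproximation, HasABApproximation.hasFPDHull⟩

theorem hasFPDHull_zero_iff {m : ℕ} :
    HasFPDHull Λ 0 m M ↔ HasProjCoresolution Λ (m + 1) M :=
  ⟨fun ⟨Y, X, g, p, h, hm⟩ => ⟨Y, X, g, p, h.shortExact,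
    projective_of_hasProjectiveDimensionLE_zero h.pd, h.ext, hm⟩,
  fun ⟨Y, X, g, p, h, _, hX, hm⟩ => ⟨Y, X, g, p,
    ⟨h, hasProjectiveDimensionLE_of_projective 0, hX⟩, hm⟩⟩

theorem hasABApproximation_succ_iff [IsNoetherianRing Λᵐᵒᵖ] {n m : ℕ} {i : L →ₗ[Λᵐᵒᵖ] P}
    {q : P →ₗ[Λᵐᵒᵖ] M} (h : IsShortExact Λ i q) [Module.Projective Λᵐᵒᵖ P] :
    HasABApproximation Λ (n + 1) m M ↔ HasFPDHull Λ n m L := by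
  have hP := h.finite_mid
  constructor
  · rintro ⟨Z, W, j, f, hf, hm⟩
    have hW := hf.shortExact.finite_mid
    -- The pullback of `f` and `q` is an extension of `P` by `Z` and of `W` by `L`, so it serves as
    -- the middle term of a hull of `L`.
    have hE := hf.shortExact.pullback_left q
    exact ⟨ModuleCat.of _ (Pullback f q), W, _, _, ⟨h.pullback_right f,
      hasProjectiveDimensionLT_mid hE.injective hE.exact hE.surjective hf.pd, hf.ext⟩, hm⟩
  · rintro ⟨Y, X, g, p, hg, hm⟩
    have hY := hg.shortExact.finite_mid
    have hX := hg.shortExact.finite_right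
    have hgp := hg.shortExact
    -- Since `Ext¹(X, Λ) = 0`, the inclusion of the syzygy into `P` extends to `t : Y → P`. With the
    -- induced `r : X → M` this gives `0 → Y → X ⊕ P → M → 0`.
    obtain ⟨t, ht⟩ := exists_extension_of_dual g
      ((hg.ext.mono (by lia)).exists_extension hgp.injective hgp.exact hgp.surjective) i
    have ht (l : L) : t (g l) = i l := LinearMap.congr_fun ht l
    obtain ⟨r, hr⟩ := exists_comp_eq_of_ker_le hgp.surjective (q.comp t) fun y hy => by
      obtain ⟨l, rfl⟩ := (hgp.exact y).1 hy
      simp [ht, h.exact.apply_apply_eq_zero]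
    refine ⟨Y, ModuleCat.of _ (X × P), p.prod t, q.comp (LinearMap.snd _ _ _) -
      r.comp (LinearMap.fst _ _ _), ⟨⟨hY, inferInstanceAs (Module.Finite Λᵐᵒᵖ (X × P)),
        h.finite_right, ?_, ?_, fun m => ?_⟩, hg.pd, ?_⟩, hm.prod⟩
    · refine (injective_iff_map_eq_zero _).2 fun y hy => ?_
      obtain ⟨l, rfl⟩ := (hgp.exact y).1 (congrArg Prod.fst hy)
      have : i l = 0 := (ht l).symm.trans (congrArg Prod.snd hy)
      rw [(map_eq_zero_iff i h.injective).1 this, map_zero]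
    · rintro ⟨x, b⟩
      constructor
      · intro hxb
        obtain ⟨y, rfl⟩ := hgp.surjective x
        have hxb : q b - r (p y) = 0 := hxb
        rw [hr, LinearMap.comp_apply, ← map_sub] at hxb
        -- The lift `y` of `x` hits `b` only up to `i l`; adding `g l` corrects this without
        -- changing the image in `X`.
        obtain ⟨l, hl⟩ := (h.exact _).1 hxb
        exact ⟨y + g l, Prod.ext (by simp [hgp.exact.apply_apply_eq_zero]) (by simp [ht, hl])⟩
      · rintro ⟨y, hy⟩
        obtain rfl : p y = x := congrArg Prod.fst hy
        obtain rfl : t y = b := congrArg Prod.snd hy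
        exact sub_eq_zero.2 (hr y).symm
    · obtain ⟨b, rfl⟩ := h.surjective m
      exact ⟨(0, b), by simp⟩
    · exact ExtVanishes.mid LinearMap.inl_injective Function.Exact.inl_snd LinearMap.snd_surjective
        hg.ext (extVanishes_of_projective _)

theorem HasFPDHull.congr {n m : ℕ} (h : HasFPDHull Λ n m M) (e : L ≃ₗ[Λᵐᵒᵖ] M) :
    HasFPDHull Λ n m L := by
  obtain ⟨Y, X, g, p, hg, hm⟩ := h
  have := hg.shortExact.finite_left
  refine ⟨Y, X, g.comp e.toLinearMap, p, ⟨⟨Module.Finite.equiv e.symm, hg.shortExact.finite_mid,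
    hg.shortExact.finite_right, hg.shortExact.injective.comp e.injective, fun y => ?_,
    hg.shortExact.surjective⟩, hg.pd, hg.ext⟩, hm⟩
  refine (hg.shortExact.exact y).trans ⟨?_, ?_⟩
  · rintro ⟨x, rfl⟩
    exact ⟨e.symm x, by simp⟩
  · rintro ⟨x, rfl⟩
    exact ⟨e x, rfl⟩

theorem IsSyzygy.finite [Module.Finite Λᵐᵒᵖ M] {n : ℕ} (h : IsSyzygy Λ M n L) :
    Module.Finite Λᵐᵒᵖ L := by
  obtain _ | n := n
  · obtain ⟨e⟩ := h
    exact Module.Finite.equiv e.symm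
  · obtain ⟨_, _, _, _, -, -, h⟩ := h
    exact h.finite_left

theorem hasFPDHull_syzygy_iff [IsNoetherianRing Λᵐᵒᵖ] {j : ℕ} {K : Type u} [AddCommGroup K]
    [Module Λᵐᵒᵖ K] (h : IsSyzygy Λ M j K) {n m : ℕ} :
    HasFPDHull Λ (n + j) m M ↔ HasFPDHull Λ n (m + j) K := by
  induction j generalizing K n m with
  | zero =>
    obtain ⟨e⟩ := h
    exact ⟨fun h => h.congr e, fun h => h.congr e.symm⟩
  | succ j ih =>
    obtain ⟨L, P, i, p, hL, hP, hip⟩ := h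
    rw [show n + (j + 1) = n + 1 + j by lia, ih hL, hasFPDHull_iff,
      hasABApproximation_succ_iff hip, add_assoc]

/-- Functionals on `P` detect elements outside `L`, and every functional on `L` extends to `W`
because `P` is projective. -/
theorem IsTorsionless.of_extension {i : L →ₗ[Λᵐᵒᵖ] W} {p : W →ₗ[Λᵐᵒᵖ] P} (h : IsShortExact Λ i p)
    [Module.Projective Λᵐᵒᵖ P] (hL : IsTorsionless Λ L) : IsTorsionless Λ W := by
  have := h.finite_right
  refine isTorsionless_iff.2 fun w hw => ?_
  obtain ⟨l, rfl⟩ := (h.exact w).1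
    (isTorsionless_iff.1 isTorsionless_of_projective _ fun f => hw (f.comp p))
  rw [isTorsionless_iff.1 hL l fun f => ?_, map_zero]
  obtain ⟨g, rfl⟩ := (extVanishes_of_projective 1).exists_extension h.injective h.exact h.surjective f
  exact hw g

theorem IsOriginExtension.exists_isABApproximation [IsNoetherianRing Λᵐᵒᵖ] {n : ℕ}
    {i : X →ₗ[Λᵐᵒᵖ] M × P} {p : M × P →ₗ[Λᵐᵒᵖ] Y} (h : IsOriginExtension Λ n i p)
    (hX : IsTorsionless Λ X) :
    ∃ (Z W : ModuleCat.{u} Λᵐᵒᵖ) (i : Z →ₗ[Λᵐᵒᵖ] W) (f : W →ₗ[Λᵐᵒᵖ] M),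
      IsABApproximation Λ n i f ∧ IsTorsionless Λ W := by
  have hMP := h.shortExact.finite_mid
  have hY := h.shortExact.finite_right
  have hP := h.projective
  have hM : Module.Finite Λᵐᵒᵖ M := Module.Finite.of_surjective _ (LinearMap.fst_surjective
    (R := Λᵐᵒᵖ) (M := M) (M₂ := P))
  have hPf : Module.Finite Λᵐᵒᵖ P := Module.Finite.of_surjective _ (LinearMap.snd_surjective
    (R := Λᵐᵒᵖ) (M := M) (M₂ := P))
  obtain ⟨Z, Q, j, q, hZ, hQf, hQ, hj, hjq, hq, hpd⟩ := exists_projective_resolution_step h.pd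
  have hjq : IsShortExact Λ j q := ⟨hZ, hQf, hY, hj, hjq, hq⟩
  let g : M →ₗ[Λᵐᵒᵖ] Y := p.comp (LinearMap.inl _ _ _)
  -- Pulling `Q → Y` back to `M ⊕ P` gives an extension of `Q` by `X`, so it is torsionless with the
  -- required `Ext`-vanishing. The pullback to `M` alone is the kernel of its surjection onto `P`
  -- and inherits both.
  have hE := h.shortExact.pullback_right q
  let a : Pullback q g →ₗ[Λᵐᵒᵖ] Pullback q p :=
    (((LinearMap.id).prodMap (LinearMap.inl _ _ _)).comp (Submodule.subtype _)).codRestrict _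
      fun x => x.2
  have ha : IsShortExact Λ a ((LinearMap.snd _ _ _).comp (pullbackSnd q p)) := by
    refine ⟨inferInstance, hE.finite_mid, hPf, fun x y hxy => ?_, ?_, fun b => ?_⟩
    · exact Subtype.ext (Prod.ext (congrArg (fun e => e.1.1) hxy)
        (congrArg (fun e => e.1.2.1) hxy))
    · rintro ⟨⟨x, m, b⟩, hx⟩
      constructor
      · rintro (rfl : b = 0)
        exact ⟨⟨(x, m), hx⟩, rfl⟩
      · rintro ⟨y, hy⟩
        exact (congrArg (fun e => e.1.2.2) hy).symm
    · obtain ⟨x, hx⟩ := hq (p (0, b))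
      exact ⟨⟨(x, 0, b), hx⟩, rfl⟩
  exact ⟨Z, ModuleCat.of _ (Pullback q g), _, _, ⟨hjq.pullback_left g, hpd,
    ExtVanishes.left ha.injective ha.exact ha.surjective
      (ExtVanishes.mid hE.injective hE.exact hE.surjective h.ext (extVanishes_of_projective _))
      (extVanishes_of_projective _)⟩, (hX.of_extension hE).of_injective a ha.injective⟩

end Approximation

end NFPDHull

theorem theorem3p8 (Λ : Type u) [Ring Λ] [IsNoetherianRing Λ] [IsNoetherianRing Λᵐᵒᵖ]
    (M : Type u) [AddCommGroup M] [Module Λᵐᵒᵖ M] [Module.Finite Λᵐᵒᵖ M] (n : ℕ) :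
    -- the equivalence, for every choice `K` of the `n`-th syzygy of `M`
    (∀ (K : Type u) [AddCommGroup K] [Module Λᵐᵒᵖ K], NFPDHull.IsSyzygy Λ M n K →
      List.TFAE [
        NFPDHull.IsTorsionfree Λ (n + 1) K,
        ∃ (Y X : ModuleCat.{u} Λᵐᵒᵖ) (g : M →ₗ[Λᵐᵒᵖ] Y) (p : Y →ₗ[Λᵐᵒᵖ] X),
          NFPDHull.IsFPDHull Λ n g p,
        ∃ (Z W : ModuleCat.{u} Λᵐᵒᵖ) (i : Z →ₗ[Λᵐᵒᵖ] W) (f : W →ₗ[Λᵐᵒᵖ] M),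
          NFPDHull.IsABApproximation Λ n i f ∧ NFPDHull.IsTorsionless Λ W,
        ∃ (X P Y : ModuleCat.{u} Λᵐᵒᵖ) (i : X →ₗ[Λᵐᵒᵖ] M × P) (p : M × P →ₗ[Λᵐᵒᵖ] Y),
          NFPDHull.IsOriginExtension Λ n i p ∧ NFPDHull.IsTorsionless Λ X]) ∧
    -- the construction of the hull
    (∀ (Z W P : Type u) [AddCommGroup Z] [Module Λᵐᵒᵖ Z] [AddCommGroup W] [Module Λᵐᵒᵖ W]
      [AddCommGroup P] [Module Λᵐᵒᵖ P]
      (i : Z →ₗ[Λᵐᵒᵖ] W) (f : W →ₗ[Λᵐᵒᵖ] M) (s : W →ₗ[Λᵐᵒᵖ] P),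
      NFPDHull.IsABApproximation Λ n i f → NFPDHull.IsTorsionless Λ W →
      NFPDHull.IsLeftProjApproximation Λ s →
        NFPDHull.IsFPDHull Λ n (NFPDHull.fromM Λ f s) (NFPDHull.toCoker Λ f s)) := by
  refine ⟨fun K _ _ hK => ?_, fun Z W P _ _ _ _ _ _ i f s h hW hs => ?_⟩
  · have hKf := hK.finite
    tfae_have 1 ↔ 2 := by
      rw [NFPDHull.isTorsionfree_iff, ← NFPDHull.hasFPDHull_zero_iff]
      -- All `n` units of projective dimension are traded for coresolution length.
      have := NFPDHull.hasFPDHull_syzygy_iff hK (n := 0) (m := 0)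
      rw [zero_add] at this
      rw [← this]
      exact ⟨fun ⟨Y, X, g, p, h, _⟩ => ⟨Y, X, g, p, h⟩,
        fun ⟨Y, X, g, p, h⟩ => ⟨Y, X, g, p, h, trivial⟩⟩
    tfae_have 2 → 3 := fun ⟨Y, X, g, p, h⟩ => by
      obtain ⟨Z, W, i, f, hf, hW⟩ :=
        NFPDHull.HasFPDHull.hasABApproximation (m := 0) ⟨Y, X, g, p, h, trivial⟩
      have := hf.shortExact.finite_mid
      exact ⟨Z, W, i, f, hf, NFPDHull.hasProjCoresolution_one_iff.1 hW⟩
    tfae_have 3 → 2 := fun ⟨Z, W, i, f, hf, hW⟩ => by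
      have := hf.shortExact.finite_mid
      obtain ⟨Y, X, g, p, h, -⟩ := NFPDHull.HasABApproximation.hasFPDHull (m := 0)
        ⟨Z, W, i, f, hf, NFPDHull.hasProjCoresolution_one_iff.2 hW⟩
      exact ⟨Y, X, g, p, h⟩
    tfae_have 3 → 4 := fun ⟨Z, W, i, f, hf, hW⟩ => by
      have := hf.shortExact.finite_mid
      obtain ⟨P, s, hPf, hP, hs⟩ := NFPDHull.exists_dualMap_surjective (Λ := Λ) W
      exact ⟨W, P, ModuleCat.of _ (NFPDHull.PushoutCoker Λ f s), f.prod s, _,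
        hf.isOriginExtension (NFPDHull.injective_of_dualMap_surjective hW s hs), hW⟩
    tfae_have 4 → 3 := fun ⟨X, P, Y, i, p, h, hX⟩ => h.exists_isABApproximation hX
    tfae_finish
  · have := hs.finite
    have := hs.projective
    exact h.isFPDHull (NFPDHull.injective_of_dualMap_surjective hW s hs.dualMap_surjective)
      hs.dualMap_surjective
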